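/- **Theorem (certifiable lower bound of the Wigner negativity volume).** Let $\rho$ be a density operator (positive, trace one) on the Hilbert space $L^2(\mathbb R^M)$ of $M$ bosonic modes with annihilation operators $a_m=(x_m+\partial_m)/\sqrt2$. For $\vec\xi\in\mathbb C^M$ let $D(\vec\xi)=\exp\big(\sum_{m=1}^M(\xi_m a_m^\dagger-\xi_m^* a_m)\big)$ be the displacement operator, i.e. $(D(\vec\xi)\psi)(x)=e^{i\sum_m(\sqrt2\,\mathrm{Im}\,\xi_m\,x_m-\mathrm{Re}\,\xi_m\,\mathrm{Im}\,\xi_m)}\,\psi(x-\sqrt2\,\mathrm{Re}\,\vec\xi)$. Let $$W_\rho(\vec\alpha)=\Big(\frac2\pi\Big)^M\operatorname{tr}\big[\rho\,D(\vec\alpha)\,\Pi\,D(\vec\alpha)^\dagger\big],\qquad (\Pi\psi)(x)=\psi(-x),$$ be the Wigner function of $\rho$, a real function on $\mathbb C^M$, and let $$\mathcal N_V(\rho)=\frac12\int_{\mathbb C^M}\big(|W_\rho(\vec\alpha)|-W_\rho(\vec\alpha)\big)\,d^{2M}\vec\alpha\in[0,\infty],\qquad d^{2M}\vec\alpha=\prod_m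 d\,\mathrm{Re}\,\alpha_m\,d\,\mathrm{Im}\,\alpha_m,$$ be its Wigner negativity volume. Let $N\ge1$, let $\Xi=(\vec\xi_1,\dots,\vec\xi_N)$ be any points of $\mathbb C^M$, and let $\mathbf C(\rho,\Xi)$ be the $N\times N$ matrix with entries $$[\mathbf C(\rho,\Xi)]_{j,k}=\frac1N\operatorname{tr}\big[\rho\,D(\vec\xi_j-\vec\xi_k)\big].$$ Then $\mathbf C(\rho,\Xi)$ is Hermitian, so that it has a smallest eigenvalue $\lambda_-$, and $\mathcal N_C(\rho,\Xi):=\max(0,-\lambda_-)$ satisfies $$\mathcal N_C(\rho,\Xi)\le\mathcal N_V(\rho).$$ -/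

import Mathlib

open MeasureTheory
open scoped ENNReal

noncomputable section

namespace WignerNeg

/-! ### Trace and density operators on a complex Hilbert space -/

section Trace

variable (E : Type*) [NormedAddCommGroup E] [InnerProductSpace ℂ E] [CompleteSpace E]

/-- Index set of a fixed Hilbert basis of `E`. -/
def basisIndex : Set E := (exists_hilbertBasis ℂ E).choose

/-- A fixed Hilbert basis of `E`. -/
def basis : HilbertBasis (basisIndex E) ℂ E := (exists_hilbertBasis ℂ E).choose_spec.choose

variable {E}

/-- The trace `∑ᵢ ⟨eᵢ, A eᵢ⟩`. It is used only for trace-class operators (products of a density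
operator and bounded operators), where the series converges absolutely and its sum does not depend
on the Hilbert basis. -/
def trace (A : E →L[ℂ] E) : ℂ := ∑' i, inner ℂ (basis E i) (A (basis E i))

/-- Density operators: positive operators for which the series `∑ᵢ ⟨eᵢ, ρ eᵢ⟩` converges to `1`. For
a positive operator this does not depend on the Hilbert basis, and it implies trace class. -/
structure IsDensityOperator (ρ : E →L[ℂ] E) : Prop where
  isPositive : ρ.IsPositive
  hasSum_trace : HasSum (fun i => inner ℂ (basis E i) (ρ (basis E i))) 1

end Trace

/-! ### `M` bosonic modes in the Schrödinger representation -/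

/-- The Hilbert space `L²(ℝ^M; ℂ)` of `M` bosonic modes. -/
abbrev ModeSpace (M : ℕ) : Type := Lp ℂ 2 (volume : Measure (Fin M → ℝ))

/-- Annihilation operator `a_m = (x_m + ∂_m) / √2`, acting on functions. -/
def annihilation {M : ℕ} (m : Fin M) (f : (Fin M → ℝ) → ℂ) (x : Fin M → ℝ) : ℂ :=
  (x m * f x + fderiv ℝ f x (Pi.single m 1)) / (√2 : ℝ)

/-- Creation operator `a_m† = (x_m - ∂_m) / √2`, acting on functions. -/
def creation {M : ℕ} (m : Fin M) (f : (Fin M → ℝ) → ℂ) (x : Fin M → ℝ) : ℂ :=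
  (x m * f x - fderiv ℝ f x (Pi.single m 1)) / (√2 : ℝ)

/-- The phase factor in the displacement operator. -/
def displacePhase {M : ℕ} (ξ : Fin M → ℂ) (x : Fin M → ℝ) : ℂ :=
  Complex.exp (((∑ m, (√2 * (ξ m).im * x m - (ξ m).re * (ξ m).im) : ℝ) : ℂ) * Complex.I)

/-- The translation of configuration space in the displacement operator. -/
def displaceShift {M : ℕ} (ξ : Fin M → ℂ) : Fin M → ℝ := fun m => √2 * (ξ m).re

/-- The action of `D(ξ) = exp (∑ₘ ξₘ aₘ† - ξₘ* aₘ)` on functions on `ℝ^M`. The lemmas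
`displaceFun_add` and `hasDerivAt_displaceFun` say that `t ↦ D(tξ)` is a one-parameter group with
generator `∑ₘ ξₘ aₘ† - ξₘ* aₘ`. -/
def displaceFun {M : ℕ} (ξ : Fin M → ℂ) (f : (Fin M → ℝ) → ℂ) (x : Fin M → ℝ) : ℂ :=
  displacePhase ξ x * f (x - displaceShift ξ)

theorem displaceFun_add {M : ℕ} (ξ : Fin M → ℂ) (f : (Fin M → ℝ) → ℂ) (s t : ℝ) :
    displaceFun ((s + t) • ξ) f = displaceFun (s • ξ) (displaceFun (t • ξ) f) := by
  funext x
  have h1 : x - displaceShift ((s + t) • ξ)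
      = x - displaceShift (s • ξ) - displaceShift (t • ξ) := by
    funext m
    simp [displaceShift]
    ring
  have h2 : displacePhase ((s + t) • ξ) x
      = displacePhase (s • ξ) x * displacePhase (t • ξ) (x - displaceShift (s • ξ)) := by
    have h3 : (√2 : ℝ) * √2 = 2 := Real.mul_self_sqrt (by norm_num)
    rw [displacePhase, displacePhase, displacePhase, ← Complex.exp_add, ← add_mul,
      ← Complex.ofReal_add, ← Finset.sum_add_distrib]
    congr 3
    refine Finset.sum_congr rfl fun m _ => ?_
    simp only [displaceShift, Pi.smul_apply, Pi.sub_apply, Complex.real_smul, Complex.re_ofReal_mul,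
      Complex.im_ofReal_mul]
    linear_combination (t * (ξ m).im * s * (ξ m).re) * h3
  simp only [displaceFun, h1, h2, mul_assoc]

theorem hasDerivAt_displaceFun {M : ℕ} (ξ : Fin M → ℂ) (f : (Fin M → ℝ) → ℂ) (x : Fin M → ℝ)
    (hf : DifferentiableAt ℝ f x) :
    HasDerivAt (fun t : ℝ => displaceFun (t • ξ) f x)
      (∑ m, (ξ m * creation m f x - starRingEnd ℂ (ξ m) * annihilation m f x)) 0 := by
  have hs : ((√2 : ℝ) : ℂ) * ((√2 : ℝ) : ℂ) = 2 := by
    rw [← Complex.ofReal_mul, Real.mul_self_sqrt (by norm_num)]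
    norm_num
  have hs0 : ((√2 : ℝ) : ℂ) ≠ 0 := by
    simp
  have hphase : HasDerivAt (fun t : ℝ => displacePhase (t • ξ) x)
      (((∑ m, √2 * (ξ m).im * x m : ℝ) : ℂ) * Complex.I) 0 := by
    have h1 : HasDerivAt (fun t : ℝ => ∑ m, (√2 * ((t • ξ) m).im * x m
        - ((t • ξ) m).re * ((t • ξ) m).im)) (∑ m, √2 * (ξ m).im * x m) 0 := by
      refine HasDerivAt.fun_sum fun m _ => ?_
      have h2 := (((hasDerivAt_id (0 : ℝ)).mul_const (√2 * (ξ m).im * x m)).sub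
        (((hasDerivAt_id (0 : ℝ)).pow 2).mul_const ((ξ m).re * (ξ m).im)))
      convert h2 using 1
      · funext t
        simp
        ring
      · simp
    have h3 := (h1.ofReal_comp.mul_const Complex.I).cexp
    refine h3.congr_deriv ?_
    simp
  have hshift : HasDerivAt (fun t : ℝ => f (x - displaceShift (t • ξ)))
      (fderiv ℝ f x (-displaceShift ξ)) 0 := by
    have h1 : HasDerivAt (fun t : ℝ => x - displaceShift (t • ξ)) (-displaceShift ξ) 0 := by
      have h2 := ((hasDerivAt_id (0 : ℝ)).smul_const (displaceShift ξ)).const_sub x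
      have h3 : (fun t : ℝ => x - displaceShift (t • ξ))
          = fun t : ℝ => x - id t • displaceShift ξ := by
        funext t m
        simp [displaceShift]
        ring
      rw [h3]
      exact h2.congr_deriv (by rw [one_smul])
    have h0 : x - displaceShift ((0 : ℝ) • ξ) = x := by
      funext m
      simp [displaceShift]
    have hf' : HasFDerivAt f (fderiv ℝ f x) (x - displaceShift ((0 : ℝ) • ξ)) := by
      rw [h0]
      exact hf.hasFDerivAt
    exact hf'.comp_hasDerivAt (0 : ℝ) h1
  have h := hphase.mul hshift
  refine h.congr_deriv ?_
  symm
  have e1 : displacePhase ((0 : ℝ) • ξ) x = 1 := by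
    simp [displacePhase]
  have e2 : x - displaceShift ((0 : ℝ) • ξ) = x := by
    funext m
    simp [displaceShift]
  have e3 : fderiv ℝ f x (-displaceShift ξ)
      = -∑ m, ((√2 : ℝ) : ℂ) * ((ξ m).re : ℂ) * fderiv ℝ f x (Pi.single m 1) := by
    rw [map_neg]
    congr 1
    conv_lhs => rw [pi_eq_sum_univ' (displaceShift ξ)]
    rw [map_sum]
    refine Finset.sum_congr rfl fun m _ => ?_
    rw [map_smul, Complex.real_smul]
    congr 1
    simp [displaceShift]
  rw [e1, e2, e3]
  push_cast
  rw [Finset.sum_mul, Finset.sum_mul, one_mul, ← Finset.sum_neg_distrib, ← Finset.sum_add_distrib]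
  refine Finset.sum_congr rfl fun m _ => ?_
  have hz : ξ m = ((ξ m).re : ℂ) + ((ξ m).im : ℂ) * Complex.I := (Complex.re_add_im _).symm
  have hzc : starRingEnd ℂ (ξ m) = ((ξ m).re : ℂ) - ((ξ m).im : ℂ) * Complex.I := by
    apply Complex.ext <;> simp
  rw [creation, annihilation, hzc]
  nth_rewrite 1 [hz]
  field_simp
  linear_combination (((ξ m).re : ℂ) * fderiv ℝ f x (Pi.single m 1)
    - ((ξ m).im : ℂ) * Complex.I * x m * f x) * hs

theorem continuous_displacePhase {M : ℕ} (ξ : Fin M → ℂ) : Continuous (displacePhase ξ) := by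
  unfold displacePhase
  fun_prop

theorem norm_displacePhase {M : ℕ} (ξ : Fin M → ℂ) (x : Fin M → ℝ) : ‖displacePhase ξ x‖ = 1 :=
  Complex.norm_exp_ofReal_mul_I _

theorem eLpNorm_displaceFun {M : ℕ} (ξ : Fin M → ℂ) {f : (Fin M → ℝ) → ℂ}
    (hf : AEStronglyMeasurable f volume) :
    eLpNorm (displaceFun ξ f) 2 volume = eLpNorm f 2 volume := by
  rw [← eLpNorm_comp_measurePreserving hf (measurePreserving_sub_right volume (displaceShift ξ))]
  refine eLpNorm_congr_norm_ae (Filter.Eventually.of_forall fun x => ?_)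
  simp [displaceFun, norm_displacePhase]

theorem memLp_displaceFun {M : ℕ} (ξ : Fin M → ℂ) {f : (Fin M → ℝ) → ℂ}
    (hf : MemLp f 2 volume) : MemLp (displaceFun ξ f) 2 volume := by
  refine ⟨(continuous_displacePhase ξ).aestronglyMeasurable.mul
    (hf.1.comp_measurePreserving (measurePreserving_sub_right volume (displaceShift ξ))), ?_⟩
  rw [eLpNorm_displaceFun ξ hf.1]
  exact hf.2

theorem displaceFun_congr {M : ℕ} (ξ : Fin M → ℂ) {f g : (Fin M → ℝ) → ℂ}
    (h : f =ᵐ[volume] g) : displaceFun ξ f =ᵐ[volume] displaceFun ξ g := by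
  have h' := (measurePreserving_sub_right volume
    (displaceShift ξ)).quasiMeasurePreserving.ae_eq_comp h
  filter_upwards [h'] with x hx
  simpa [displaceFun, norm_displacePhase] using Or.inl hx

/-- The displacement operator `D(ξ)` on `L²(ℝ^M; ℂ)`. -/
def displacementIsometry {M : ℕ} (ξ : Fin M → ℂ) : ModeSpace M →ₗᵢ[ℂ] ModeSpace M where
  toFun f := (memLp_displaceFun ξ (Lp.memLp f)).toLp
  map_add' f g := by
    rw [← MemLp.toLp_add, MemLp.toLp_eq_toLp_iff]
    refine (displaceFun_congr ξ (Lp.coeFn_add f g)).trans (Filter.Eventually.of_forall fun x => ?_)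
    simp [displaceFun, mul_add]
  map_smul' c f := by
    rw [RingHom.id_apply, ← MemLp.toLp_const_smul, MemLp.toLp_eq_toLp_iff]
    refine (displaceFun_congr ξ (Lp.coeFn_smul c f)).trans (Filter.Eventually.of_forall fun x => ?_)
    simp [displaceFun, mul_left_comm]
  norm_map' f := by
    change ‖(memLp_displaceFun ξ (Lp.memLp f)).toLp‖ = _
    rw [Lp.norm_toLp, eLpNorm_displaceFun ξ (Lp.memLp f).1, Lp.norm_def]

/-- The displacement operator `D(ξ)` as a bounded operator. -/
def displacement {M : ℕ} (ξ : Fin M → ℂ) : ModeSpace M →L[ℂ] ModeSpace M :=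
  (displacementIsometry ξ).toContinuousLinearMap

/-- The parity operator `(Πψ)(x) = ψ(-x)`. -/
def parity (M : ℕ) : ModeSpace M →L[ℂ] ModeSpace M :=
  (Lp.compMeasurePreservingₗᵢ ℂ (fun x : Fin M → ℝ => -x)
    (Measure.measurePreserving_neg volume)).toContinuousLinearMap

/-! ### Wigner function, negativity volume and the witness -/

/-- The Wigner function `W_ρ(α) = (2/π)^M tr[ρ D(α) Π D(α)†]`. The trace is real for a density
operator, since `D(α) Π D(α)†` is self-adjoint. It is normalised with respect to
`∏ₘ d(Re αₘ) d(Im αₘ)`, which is the Lebesgue measure `volume` on `Fin M → ℂ`. -/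
def wigner {M : ℕ} (ρ : ModeSpace M →L[ℂ] ModeSpace M) (α : Fin M → ℂ) : ℝ :=
  (2 / Real.pi) ^ M *
    (trace (ρ ∘L displacement α ∘L parity M ∘L
      ContinuousLinearMap.adjoint (displacement α))).re

/-- The Wigner negativity volume `½ ∫ (|W_ρ| - W_ρ)`, with values in `[0, ∞]`. -/
def negativityVolume {M : ℕ} (ρ : ModeSpace M →L[ℂ] ModeSpace M) : ℝ≥0∞ :=
  (1 / 2) * ∫⁻ α : Fin M → ℂ, ENNReal.ofReal (|wigner ρ α| - wigner ρ α)

/-- The matrix `C(ρ, Ξ)` with entries `(1/N) tr[ρ D(ξⱼ - ξₖ)]`. -/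
def charMatrix {M N : ℕ} (ρ : ModeSpace M →L[ℂ] ModeSpace M) (Ξ : Fin N → Fin M → ℂ) :
    Matrix (Fin N) (Fin N) ℂ :=
  Matrix.of fun j k => (1 / (N : ℂ)) * trace (ρ ∘L displacement (Ξ j - Ξ k))

/-- The real eigenvalues of a complex square matrix. -/
def realEigenvalues {N : ℕ} (C : Matrix (Fin N) (Fin N) ℂ) : Set ℝ :=
  {μ : ℝ | Module.End.HasEigenvalue (Matrix.toLin' C) (μ : ℂ)}

/-- The smallest eigenvalue of a Hermitian matrix. -/
def smallestEigenvalue {N : ℕ} (C : Matrix (Fin N) (Fin N) ℂ) : ℝ := sInf (realEigenvalues C)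

/-- The witness `N_C(ρ, Ξ) = max(0, -λ₋)`. -/
def witness {M N : ℕ} (ρ : ModeSpace M →L[ℂ] ModeSpace M) (Ξ : Fin N → Fin M → ℂ) : ℝ :=
  max 0 (-smallestEigenvalue (charMatrix ρ Ξ))

end WignerNeg

end

/-! The operator `D(ξ)` is the Weyl quantisation of the character `χ_ξ = weylChar ξ`, so formally
`tr[ρ D(ξ)] = ∫ W_ρ χ_ξ`. Since `χ_(ξ-η) = χ_ξ · conj χ_η`, the quadratic form of the matrix `tr[ρ
D(ξⱼ - ξₖ)]` at `u` is `∫ W_ρ |∑ conj(uⱼ) χ_ξⱼ|²`. The weight lies between `0` and `N ‖u‖²`, so the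
integral is at least `-N ‖u‖²` times the negativity volume. At an eigenvector of `C` the form equals
`N ‖u‖² λ`, and the factors `N ‖u‖²` cancel.

The integral formula for `tr[ρ D(ξ)]` is only formal, because `W_ρ` need not be integrable. A
Gaussian `regulator r` with values in `(0, 1]` makes it rigorous without harming the bound on the
weight, and `r → 0⁺` at the end (`integrable_and_tendsto_regulator_mul_trace`).

Writing `ρ = S²` reduces traces to series of expectations in the vectors `S eᵢ`
(`IsDensityOperator.exists_hasSum_inner`). For one vector `ψ`, both the displaced parity and the
displacement are integrals of `correlation ψ`: the former is its Fourier transform in the second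
variable (`inner_displacement_parity`), the latter its value at a fixed offset, integrated against a
character in the first (`inner_displacement`). The formula is thus Fourier inversion. With the
regulator it becomes an exact Gaussian average over nearby offsets (`integral_regulator_mul_inner`),
which converges by continuity of translations in `L²` (`tendsto_gaussAverage`). -/

open MeasureTheory
open scoped ENNReal

noncomputable section

namespace WignerNeg

/-! ### Traces against a density operator as series of expectations -/

section TraceLemmas

variable {ι E : Type*} [NormedAddCommGroup E] [InnerProductSpace ℂ E]

theorem hasSum_norm_inner_sq (b : HilbertBasis ι ℂ E) (v : E) :
    HasSum (fun i => ‖inner ℂ (b i) v‖ ^ 2) (‖v‖ ^ 2) := by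
  have h := Complex.hasSum_re (b.hasSum_inner_mul_inner v v)
  have e : ∀ i, (inner ℂ v (b i) * inner ℂ (b i) v).re = ‖inner ℂ (b i) v‖ ^ 2 := fun i => by
    rw [← RCLike.re_eq_complex_re, inner_mul_symm_re_eq_norm, norm_mul, norm_inner_symm, sq]
  simp only [e] at h
  convert h
  exact norm_sq_eq_re_inner (𝕜 := ℂ) v

theorem summable_norm_inner_sq_prod (b : HilbertBasis ι ℂ E) (v : ι → E)
    (hv : Summable fun j => ‖v j‖ ^ 2) :
    Summable fun p : ι × ι => ‖inner ℂ (b p.2) (v p.1)‖ ^ 2 := by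
  rw [summable_prod_of_nonneg fun p => by positivity]
  refine ⟨fun j => (hasSum_norm_inner_sq b (v j)).summable, ?_⟩
  simpa only [(hasSum_norm_inner_sq b (v _)).tsum_eq] using hv

variable [CompleteSpace E]

open ContinuousLinearMap in
/-- Cyclicity of the trace for a self-adjoint Hilbert-Schmidt operator `S`. -/
theorem hasSum_inner_comp_of_summable (b : HilbertBasis ι ℂ E) (S A : E →L[ℂ] E)
    (hS : IsSelfAdjoint S) (hsum : Summable fun i => ‖S (b i)‖ ^ 2) :
    HasSum (fun i => inner ℂ (S (b i)) (A (S (b i))))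
      (∑' i, inner ℂ (b i) (S (S (A (b i))))) := by
  have hsymm : ∀ x y, inner ℂ (S x) y = inner ℂ x (S y) := hS.isSymmetric
  -- Parseval evaluates the row sums of `F` as `⟨S bᵢ, A S bᵢ⟩` and its column sums as `⟨bⱼ, S S A
  -- bⱼ⟩`. Absolute summability, from the Hilbert-Schmidt bounds, makes the two totals agree.
  set F : ι × ι → ℂ := fun p => inner ℂ (b p.1) (S (A (b p.2))) * inner ℂ (b p.2) (S (b p.1)) with hF
  have hsumA : Summable fun i => ‖adjoint A (S (b i))‖ ^ 2 := by
    refine Summable.of_nonneg_of_le (fun i => by positivity) (fun i => ?_)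
      (hsum.mul_left (‖adjoint A‖ ^ 2))
    rw [← mul_pow]
    gcongr
    exact le_opNorm _ _
  have hswap : ∀ i j, inner ℂ (b i) (S (A (b j))) = inner ℂ (adjoint A (S (b i))) (b j) := by
    intro i j
    rw [adjoint_inner_left, hsymm]
  have hFs : Summable F := by
    have hg := (summable_norm_inner_sq_prod b (fun i => adjoint A (S (b i))) hsumA).add
      (summable_norm_inner_sq_prod b (fun i => S (b i)) hsum)
    refine Summable.of_norm_bounded hg fun p => ?_
    have e : ‖F p‖ = ‖inner ℂ (b p.2) (adjoint A (S (b p.1)))‖ * ‖inner ℂ (b p.2) (S (b p.1))‖ := by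
      simp only [hF]
      rw [norm_mul, hswap, norm_inner_symm]
    rw [e]
    generalize ‖inner ℂ (b p.2) (adjoint A (S (b p.1)))‖ = x
    generalize ‖inner ℂ (b p.2) (S (b p.1))‖ = y
    nlinarith [sq_nonneg (x - y), sq_nonneg x, sq_nonneg y]
  have h1 : HasSum (fun i => inner ℂ (S (b i)) (A (S (b i)))) (∑' p, F p) := by
    refine hFs.hasSum.prod_fiberwise fun i => ?_
    have := b.hasSum_inner_mul_inner (adjoint A (S (b i))) (S (b i))
    rw [adjoint_inner_left] at this
    simpa only [hF, hswap] using this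
  have h2 : HasSum (fun i => inner ℂ (b i) (S (S (A (b i))))) (∑' p, F p) := by
    refine HasSum.prod_fiberwise ((Equiv.prodComm ι ι).hasSum_iff.2 hFs.hasSum) fun j => ?_
    have h := b.hasSum_inner_mul_inner (S (b j)) (S (A (b j)))
    rw [hsymm] at h
    have e : ∀ i, inner ℂ (S (b j)) (b i) * inner ℂ (b i) (S (A (b j)))
        = F ((Equiv.prodComm ι ι) (j, i)) := fun i => by
      simp only [hF, Equiv.prodComm_apply, Prod.swap_prod_mk]
      rw [hsymm, mul_comm]
    simp only [e] at h
    exact h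
  rw [h2.tsum_eq]
  exact h1

/-- The vectors are `ψᵢ = √ρ eᵢ`, with `∑ ‖ψᵢ‖² = tr ρ = 1`. Keeping only the nonzero ones makes the
index set countable, as the later exchanges of sum and integral over phase space require. -/
theorem IsDensityOperator.exists_hasSum_inner {ρ : E →L[ℂ] E} (hρ : IsDensityOperator ρ) :
    ∃ (J : Set (basisIndex E)) (ψ : J → E), J.Countable ∧ HasSum (fun i => ‖ψ i‖ ^ 2) 1 ∧
      ∀ A : E →L[ℂ] E, HasSum (fun i => inner ℂ (ψ i) (A (ψ i))) (trace (ρ ∘L A)) := by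
  have h0 : 0 ≤ ρ := (ContinuousLinearMap.nonneg_iff_isPositive ρ).2 hρ.isPositive
  set S := CFC.sqrt ρ with hSdef
  have hSS : ∀ x, S (S x) = ρ x := fun x => by
    rw [← CFC.sqrt_mul_sqrt_self ρ h0]; rfl
  have hS : IsSelfAdjoint S := (CFC.sqrt_nonneg ρ).isSelfAdjoint
  have hn : HasSum (fun i => ‖S (basis E i)‖ ^ 2) 1 := by
    have h := Complex.hasSum_re hρ.hasSum_trace
    have e : ∀ i, (inner ℂ (basis E i) (ρ (basis E i))).re = ‖S (basis E i)‖ ^ 2 := fun i => by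
      rw [← hSS, ← (show ∀ x y, inner ℂ (S x) y = inner ℂ x (S y) from hS.isSymmetric),
        ← inner_self_eq_norm_sq (𝕜 := ℂ)]; rfl
    simpa only [e, Complex.one_re] using h
  refine ⟨Function.support fun i => ‖S (basis E i)‖ ^ 2, fun i => S (basis E i),
    hn.summable.countable_support, (hasSum_subtype_iff_of_support_subset subset_rfl).2 hn,
    fun A => ?_⟩
  have h := hasSum_inner_comp_of_summable (basis E) S A hS hn.summable
  simp only [hSS] at h
  have hsupp : (Function.support fun i => inner ℂ (S (basis E i)) (A (S (basis E i))))
      ⊆ Function.support fun i => ‖S (basis E i)‖ ^ 2 := fun i hi hi' => hi (by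
    have h0 : S (basis E i) = 0 := by simpa using hi'
    simp [h0])
  exact (hasSum_subtype_iff_of_support_subset hsupp).2 h

end TraceLemmas

/-! ### Expectations of displacements and displaced parities in one vector -/

section SingleVector

variable {M : ℕ}

/-- The character `exp (i t·y)` of `ℝ^M`. -/
def phase (t y : Fin M → ℝ) : ℂ := Complex.exp ((t ⬝ᵥ y : ℝ) * Complex.I)

theorem norm_phase (t y : Fin M → ℝ) : ‖phase t y‖ = 1 := Complex.norm_exp_ofReal_mul_I _

theorem continuous_phase : Continuous fun p : (Fin M → ℝ) × (Fin M → ℝ) => phase p.1 p.2 := by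
  unfold phase dotProduct
  fun_prop

/-- The correlation `conj f(s + y) f(s - y)` of a wave function about the point `s`. -/
def correlation (f : (Fin M → ℝ) → ℂ) (s y : Fin M → ℝ) : ℂ :=
  starRingEnd ℂ (f (s + y)) * f (s - y)

theorem coeFn_displacement (ξ : Fin M → ℂ) (ψ : ModeSpace M) :
    displacement ξ ψ =ᵐ[volume] displaceFun ξ ψ :=
  MemLp.coeFn_toLp (memLp_displaceFun ξ (Lp.memLp ψ))

theorem displacement_comp_neg (ξ : Fin M → ℂ) :
    displacement ξ ∘L displacement (-ξ) = ContinuousLinearMap.id ℂ (ModeSpace M) := by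
  ext1 ψ
  refine Lp.ext ?_
  have h1 := (coeFn_displacement ξ (displacement (-ξ) ψ)).trans
    (displaceFun_congr ξ (coeFn_displacement (-ξ) ψ))
  refine h1.trans (Filter.Eventually.of_forall fun x => ?_)
  have h2 := congrFun (displaceFun_add ξ ψ 1 (-1)) x
  simp only [one_smul, neg_smul] at h2
  rw [← h2]
  simp [displaceFun, displacePhase, displaceShift, Pi.sub_def]

/-- An isometry with a right inverse is unitary, and that inverse is its adjoint. -/
theorem adjoint_displacement (ξ : Fin M → ℂ) :
    ContinuousLinearMap.adjoint (displacement ξ) = displacement (-ξ) := by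
  have h : ContinuousLinearMap.adjoint (displacement ξ) ∘L displacement ξ
      = ContinuousLinearMap.id ℂ (ModeSpace M) :=
    ((displacement ξ).norm_map_iff_adjoint_comp_self).1 (displacementIsometry ξ).norm_map
  calc _ = ContinuousLinearMap.adjoint (displacement ξ) ∘L (displacement ξ ∘L displacement (-ξ)) := by
        rw [displacement_comp_neg, ContinuousLinearMap.comp_id]
    _ = _ := by
        rw [← ContinuousLinearMap.comp_assoc, h, ContinuousLinearMap.id_comp]

/-- Centring the integration variable halfway between the two arguments of `ψ` turns them into `s ±
Re ξ / √2`, and the constant part of the phase cancels. -/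
theorem inner_displacement (ξ : Fin M → ℂ) (ψ : ModeSpace M) :
    inner ℂ ψ (displacement ξ ψ)
      = ∫ s, phase (fun m => √2 * (ξ m).im) s * correlation ψ s (fun m => (ξ m).re / √2) := by
  have h2 : (√2 : ℝ) * √2 = 2 := Real.mul_self_sqrt (by norm_num)
  have h0 : (√2 : ℝ) ≠ 0 := by positivity
  rw [L2.inner_def, ← integral_add_right_eq_self _ (fun m => (ξ m).re / √2)]
  have hae := (measurePreserving_add_right volume
    (fun m => (ξ m).re / √2)).quasiMeasurePreserving.ae_eq_comp (coeFn_displacement ξ ψ)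
  refine integral_congr_ae ?_
  filter_upwards [hae] with s hs
  simp only [Function.comp_apply] at hs
  rw [hs, RCLike.inner_apply, displaceFun, correlation]
  have e1 : s + (fun m => (ξ m).re / √2) - displaceShift ξ = s - fun m => (ξ m).re / √2 := by
    funext m
    simp only [displaceShift, Pi.add_apply, Pi.sub_apply]
    field_simp
    linear_combination (-(ξ m).re) * h2
  have e2 : displacePhase ξ (s + fun m => (ξ m).re / √2) = phase (fun m => √2 * (ξ m).im) s := by
    rw [displacePhase, phase, dotProduct]
    congr 3
    refine Finset.sum_congr rfl fun m _ => ?_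
    simp only [Pi.add_apply]
    field_simp
    ring
  rw [e1, e2]
  ring

theorem coeFn_displacement_parity (α : Fin M → ℂ) (ψ : ModeSpace M) :
    (displacement α ∘L parity M ∘L ContinuousLinearMap.adjoint (displacement α)) ψ =ᵐ[volume]
      displaceFun α (fun x => displaceFun (-α) ψ (-x)) := by
  rw [adjoint_displacement]
  refine (coeFn_displacement α _).trans (displaceFun_congr α ?_)
  refine (Lp.coeFn_compMeasurePreserving (displacement (-α) ψ)
    (Measure.measurePreserving_neg volume)).trans ?_
  exact (Measure.measurePreserving_neg volume).quasiMeasurePreserving.ae_eq_comp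
    (coeFn_displacement (-α) ψ)

/-- The expectation of the displaced parity as a Fourier integral of the correlation. -/
def fourierCorrelation (f : (Fin M → ℝ) → ℂ) (s t : Fin M → ℝ) : ℂ :=
  ∫ y, phase t y * correlation f s y

/-- The displaced parity reflects configuration space about `√2 Re α`. Taking that point as origin
sends `y` to `-y`, and the two displacement phases combine into one character. -/
theorem inner_displacement_parity (α : Fin M → ℂ) (ψ : ModeSpace M) :
    inner ℂ ψ ((displacement α ∘L parity M ∘L ContinuousLinearMap.adjoint (displacement α)) ψ)
      = fourierCorrelation ψ (fun m => √2 * (α m).re) (fun m => 2 * √2 * (α m).im) := by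
  have h2 : (√2 : ℝ) * √2 = 2 := Real.mul_self_sqrt (by norm_num)
  rw [L2.inner_def, ← integral_add_left_eq_self _ (fun m => √2 * (α m).re), fourierCorrelation]
  have hae := (measurePreserving_add_left volume
    (fun m => √2 * (α m).re)).quasiMeasurePreserving.ae_eq_comp (coeFn_displacement_parity α ψ)
  refine integral_congr_ae ?_
  filter_upwards [hae] with y hy
  simp only [Function.comp_apply] at hy
  rw [hy, RCLike.inner_apply, displaceFun, displaceFun, correlation]
  have e1 : -((fun m => √2 * (α m).re) + y - displaceShift α) - displaceShift (-α)
      = (fun m => √2 * (α m).re) - y := by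
    funext m
    simp only [displaceShift, Pi.add_apply, Pi.sub_apply, Pi.neg_apply, Complex.neg_re]
    ring
  have e2 : displacePhase α ((fun m => √2 * (α m).re) + y)
      * displacePhase (-α) (-((fun m => √2 * (α m).re) + y - displaceShift α))
      = phase (fun m => 2 * √2 * (α m).im) y := by
    rw [displacePhase, displacePhase, phase, dotProduct, ← Complex.exp_add, ← add_mul,
      ← Complex.ofReal_add, ← Finset.sum_add_distrib]
    congr 3
    refine Finset.sum_congr rfl fun m _ => ?_
    simp only [displaceShift, Pi.add_apply, Pi.sub_apply, Pi.neg_apply, Complex.neg_re,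
      Complex.neg_im]
    linear_combination ((α m).re * (α m).im) * h2
  rw [e1, ← e2]
  ring

end SingleVector

/-! ### Translations in `L²` -/

section Translation

variable {M : ℕ}

theorem integral_norm_mul_le_eLpNorm {X : Type*} [MeasurableSpace X] {μ : Measure X} {f g : X → ℂ}
    (hf : MemLp f 2 μ) (hg : MemLp g 2 μ) :
    ∫ x, ‖f x * g x‖ ∂μ ≤ (eLpNorm f 2 μ).toReal * (eLpNorm g 2 μ).toReal := by
  have h := eLpNorm_smul_le_mul_eLpNorm (p := 2) (q := 2) (r := 1) hg.1 hf.1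
  rw [eLpNorm_one_eq_lintegral_enorm] at h
  change ∫ x, ‖(f * g) x‖ ∂μ ≤ _
  rw [integral_norm_eq_lintegral_enorm (hf.1.mul hg.1), ← ENNReal.toReal_mul]
  exact ENNReal.toReal_mono (ENNReal.mul_ne_top hf.2.ne hg.2.ne) h

theorem memLp_comp_add_right (ψ : ModeSpace M) (h : Fin M → ℝ) :
    MemLp (fun s => ψ (s + h)) 2 volume :=
  (Lp.memLp ψ).comp_measurePreserving (measurePreserving_add_right volume h)

theorem eLpNorm_comp_add_right (ψ : ModeSpace M) (h : Fin M → ℝ) :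
    (eLpNorm (fun s => ψ (s + h)) 2 volume).toReal = ‖ψ‖ := by
  rw [Lp.norm_def, ← eLpNorm_comp_measurePreserving (Lp.memLp ψ).1
    (measurePreserving_add_right volume h)]
  rfl

theorem memLp_comp_sub_left (ψ : ModeSpace M) (s : Fin M → ℝ) :
    MemLp (fun y => ψ (s - y)) 2 volume :=
  (Lp.memLp ψ).comp_measurePreserving (Measure.measurePreserving_sub_left volume s)

theorem eLpNorm_comp_sub_left (ψ : ModeSpace M) (s : Fin M → ℝ) :
    (eLpNorm (fun y => ψ (s - y)) 2 volume).toReal = ‖ψ‖ := by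
  rw [Lp.norm_def, ← eLpNorm_comp_measurePreserving (Lp.memLp ψ).1
    (Measure.measurePreserving_sub_left volume s)]
  rfl

theorem tendsto_eLpNorm_translate_sub (ψ : ModeSpace M) (c : Fin M → ℝ) :
    Filter.Tendsto (fun y : Fin M → ℝ =>
      (eLpNorm (fun s => ψ (s + y) - ψ (s + c)) 2 volume).toReal) (nhds c) (nhds 0) := by
  let T : C(Fin M → ℝ, C(Fin M → ℝ, Fin M → ℝ)) :=
    ContinuousMap.curry ⟨fun p => p.2 + p.1, by fun_prop⟩
  have hT : ∀ y, MeasurePreserving (T y) (volume : Measure (Fin M → ℝ)) volume := fun y =>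
    measurePreserving_add_right volume y
  have hc : Continuous fun y => Lp.compMeasurePreserving (T y) (hT y) ψ :=
    continuous_const.compMeasurePreservingLp T.continuous hT (by simp)
  have h1 : Filter.Tendsto (fun y => ‖Lp.compMeasurePreserving (T y) (hT y) ψ
      - Lp.compMeasurePreserving (T c) (hT c) ψ‖) (nhds c) (nhds 0) := by
    have h2 := ((hc.sub continuous_const).norm (E := ModeSpace M)).tendsto (x := c)
      (f := fun y => ‖Lp.compMeasurePreserving (T y) (hT y) ψ
      - Lp.compMeasurePreserving (T c) (hT c) ψ‖)
    simpa using h2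
  refine h1.congr fun y => ?_
  rw [Lp.norm_def]
  congr 1
  refine eLpNorm_congr_ae ?_
  filter_upwards [Lp.coeFn_sub (Lp.compMeasurePreserving (T y) (hT y) ψ)
    (Lp.compMeasurePreserving (T c) (hT c) ψ), Lp.coeFn_compMeasurePreserving ψ (hT y),
    Lp.coeFn_compMeasurePreserving ψ (hT c)] with s h1 h2 h3
  rw [h1, Pi.sub_apply, h2, h3]
  rfl

end Translation

/-! ### Integrability and `L¹` continuity of the correlation -/

section Correlation

variable {M : ℕ}

theorem stronglyMeasurable_correlation (ψ : ModeSpace M) :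
    StronglyMeasurable fun p : (Fin M → ℝ) × (Fin M → ℝ) => correlation ψ p.1 p.2 := by
  have h1 := (Lp.stronglyMeasurable ψ).comp_measurable
    (measurable_fst.add measurable_snd : Measurable fun p : (Fin M → ℝ) × (Fin M → ℝ) => p.1 + p.2)
  have h2 := (Lp.stronglyMeasurable ψ).comp_measurable
    (measurable_fst.sub measurable_snd : Measurable fun p : (Fin M → ℝ) × (Fin M → ℝ) => p.1 - p.2)
  exact (Complex.continuous_conj.comp_stronglyMeasurable h1).mul h2

theorem integrable_correlation_left (ψ : ModeSpace M) (y : Fin M → ℝ) :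
    Integrable (fun s => correlation ψ s y) volume := by
  have h := (memLp_comp_add_right ψ y).star.integrable_mul (memLp_comp_add_right ψ (-y))
  simp only [← sub_eq_add_neg] at h
  exact h

theorem integrable_correlation_right (ψ : ModeSpace M) (s : Fin M → ℝ) :
    Integrable (fun y => correlation ψ s y) volume := by
  have h := (memLp_comp_add_right ψ s).star.integrable_mul (memLp_comp_sub_left ψ s)
  simp only [add_comm _ s] at h
  exact h

theorem norm_correlation (f : (Fin M → ℝ) → ℂ) (s y : Fin M → ℝ) :
    ‖correlation f s y‖ = ‖f (s + y) * f (s - y)‖ := by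
  rw [correlation, norm_mul, norm_mul, RCLike.norm_conj]

/-- Cauchy-Schwarz and translation invariance. The bound is uniform in `y` and supplies the
dominating functions of the later limits. -/
theorem integral_norm_correlation_left_le (ψ : ModeSpace M) (y : Fin M → ℝ) :
    ∫ s, ‖correlation ψ s y‖ ≤ ‖ψ‖ ^ 2 := by
  have h := integral_norm_mul_le_eLpNorm (memLp_comp_add_right ψ y) (memLp_comp_add_right ψ (-y))
  rw [eLpNorm_comp_add_right, eLpNorm_comp_add_right, ← sq] at h
  simpa only [norm_correlation, sub_eq_add_neg] using h

theorem integral_norm_correlation_right_le (ψ : ModeSpace M) (s : Fin M → ℝ) :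
    ∫ y, ‖correlation ψ s y‖ ≤ ‖ψ‖ ^ 2 := by
  have h := integral_norm_mul_le_eLpNorm (memLp_comp_add_right ψ s) (memLp_comp_sub_left ψ s)
  rw [eLpNorm_comp_add_right, eLpNorm_comp_sub_left, ← sq] at h
  simpa only [norm_correlation, add_comm s] using h

theorem tendsto_integral_norm_correlation_sub (ψ : ModeSpace M) (c : Fin M → ℝ) :
    Filter.Tendsto (fun y => ∫ s, ‖correlation ψ s y - correlation ψ s c‖) (nhds c) (nhds 0) := by
  have h1 := tendsto_eLpNorm_translate_sub ψ c
  have h2 := (tendsto_eLpNorm_translate_sub ψ (-c)).comp (continuous_neg.tendsto c)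
  have h3 := (h1.mul_const ‖ψ‖).add (h2.const_mul ‖ψ‖)
  simp only [zero_mul, mul_zero, add_zero] at h3
  refine squeeze_zero (fun y => by positivity) (fun y => ?_) h3
  have d1 : MemLp (fun s => ψ (s + y) - ψ (s + c)) 2 volume :=
    (memLp_comp_add_right ψ y).sub (memLp_comp_add_right ψ c)
  have d2 : MemLp (fun s => ψ (s + -y) - ψ (s + -c)) 2 volume :=
    (memLp_comp_add_right ψ (-y)).sub (memLp_comp_add_right ψ (-c))
  have i1 := integral_norm_mul_le_eLpNorm d1 (memLp_comp_add_right ψ (-y))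
  have i2 := integral_norm_mul_le_eLpNorm (memLp_comp_add_right ψ c) d2
  rw [eLpNorm_comp_add_right] at i1 i2
  refine le_trans ?_ (add_le_add i1 i2)
  have j1 := (d1.integrable_mul (memLp_comp_add_right ψ (-y))).norm
  have j2 := ((memLp_comp_add_right ψ c).integrable_mul d2).norm
  simp only [Pi.mul_apply] at j1 j2
  rw [← integral_add j1 j2]
  refine integral_mono ((integrable_correlation_left ψ y).sub
    (integrable_correlation_left ψ c)).norm (j1.add j2) fun s => ?_
  -- Changing one factor of the product at a time leaves an `L²` translation error times a function
  -- of norm `‖ψ‖`.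
  have e : correlation ψ s y - correlation ψ s c
      = starRingEnd ℂ (ψ (s + y) - ψ (s + c)) * ψ (s + -y)
        + starRingEnd ℂ (ψ (s + c)) * (ψ (s + -y) - ψ (s + -c)) := by
    simp only [correlation, sub_eq_add_neg, map_add, map_neg]
    ring
  simp only [e]
  refine (norm_add_le _ _).trans_eq ?_
  simp only [norm_mul, RCLike.norm_conj]

end Correlation

/-! ### Gaussians and their Fourier transforms -/

section Gaussian

variable {M : ℕ}

/-- The Gaussian `exp (-r² |s|²)` on `ℝ^M`. -/
def gauss (r : ℝ) (s : Fin M → ℝ) : ℝ := Real.exp (-(r ^ 2 * (s ⬝ᵥ s)))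

theorem gauss_pos (r : ℝ) (s : Fin M → ℝ) : 0 < gauss r s := Real.exp_pos _

theorem gauss_le_one (r : ℝ) (s : Fin M → ℝ) : gauss r s ≤ 1 := by
  refine Real.exp_le_one_iff.2 (neg_nonpos.2 (mul_nonneg (sq_nonneg r) ?_))
  exact Finset.sum_nonneg fun m _ => mul_self_nonneg (s m)

theorem norm_gauss_le_one (r : ℝ) (s : Fin M → ℝ) : ‖(gauss r s : ℂ)‖ ≤ 1 := by
  rw [Complex.norm_real, Real.norm_of_nonneg (gauss_pos r s).le]
  exact gauss_le_one r s

theorem continuous_gauss : Continuous fun p : ℝ × (Fin M → ℝ) => gauss p.1 p.2 := by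
  unfold gauss dotProduct
  fun_prop

theorem gauss_mul_phase_eq (r : ℝ) (v t : Fin M → ℝ) :
    (gauss r t : ℂ) * phase v t
      = Complex.exp (-((r ^ 2 : ℝ) : ℂ) * ∑ m, (t m : ℂ) ^ 2
        + ∑ m, (v m * Complex.I) * (t m : ℂ)) := by
  rw [gauss, phase, Complex.ofReal_exp, ← Complex.exp_add]
  congr 1
  simp only [dotProduct]
  push_cast
  rw [Finset.sum_mul]
  congr 1
  · rw [neg_mul]
    simp only [sq]
  · exact Finset.sum_congr rfl fun m _ => by ring

theorem integral_gauss_mul_phase {r : ℝ} (hr : 0 < r) (v : Fin M → ℝ) :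
    ∫ t, (gauss r t : ℂ) * phase v t = ((√Real.pi / r) ^ M : ℝ) * gauss (1 / (2 * r)) v := by
  have hr2 : 0 < (((r ^ 2 : ℝ) : ℂ)).re := by
    rw [Complex.ofReal_re]
    positivity
  simp only [gauss_mul_phase_eq]
  rw [GaussianFourier.integral_cexp_neg_mul_sum_add hr2]
  congr 1
  · rw [← Complex.ofReal_div, Fintype.card_fin]
    have h : ((M : ℂ) / 2) = (((1 / 2 : ℝ) * (M : ℝ) : ℝ) : ℂ) := by
      push_cast
      ring
    rw [h, ← Complex.ofReal_cpow (by positivity), Real.rpow_mul (by positivity), Real.rpow_natCast,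
      ← Real.sqrt_eq_rpow, Real.sqrt_div Real.pi_pos.le, Real.sqrt_sq hr.le]
  · rw [gauss, Complex.ofReal_exp]
    congr 1
    simp only [mul_pow, Complex.I_sq, dotProduct]
    push_cast
    rw [← Finset.sum_mul]
    have : (r : ℂ) ≠ 0 := by exact_mod_cast hr.ne'
    field_simp
    norm_num

theorem integrable_gauss {r : ℝ} (hr : 0 < r) : Integrable (fun t : Fin M → ℝ => gauss r t) := by
  have hr2 : 0 < (((r ^ 2 : ℝ) : ℂ)).re := by
    rw [Complex.ofReal_re]
    positivity
  have h := (GaussianFourier.integrable_cexp_neg_mul_sum_add hr2 (fun _ : Fin M => 0)).norm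
  refine h.congr (Filter.Eventually.of_forall fun t => ?_)
  have e := gauss_mul_phase_eq r (0 : Fin M → ℝ) t
  simp only [Pi.zero_apply, Complex.ofReal_zero, zero_mul] at e
  simp only [zero_mul]
  rw [← e, norm_mul, norm_phase, mul_one, Complex.norm_real, Real.norm_of_nonneg (gauss_pos r t).le]

theorem integral_gauss_one : ∫ t : Fin M → ℝ, gauss 1 t = √Real.pi ^ M := by
  have h := integral_gauss_mul_phase one_pos (0 : Fin M → ℝ)
  have e : ∀ t : Fin M → ℝ, (gauss 1 t : ℂ) * phase 0 t = ((gauss 1 t : ℝ) : ℂ) := fun t => by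
    simp [phase]
  simp only [e, integral_complex_ofReal] at h
  have e2 : gauss (1 / (2 * 1)) (0 : Fin M → ℝ) = 1 := by simp [gauss]
  rw [e2, div_one, Complex.ofReal_one, mul_one] at h
  exact_mod_cast h

theorem gauss_smul (r c : ℝ) (s : Fin M → ℝ) : gauss r (c • s) = gauss (r * c) s := by
  simp only [gauss, smul_dotProduct, dotProduct_smul, smul_eq_mul]
  congr 2
  ring

end Gaussian

/-! ### Regularised Fourier inversion and its limit -/

section Smoothing

variable {M : ℕ}

theorem phase_sub_left (c y t : Fin M → ℝ) : phase (-c) t * phase t y = phase (y - c) t := by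
  rw [phase, phase, phase, ← Complex.exp_add, ← add_mul, ← Complex.ofReal_add]
  congr 3
  rw [sub_dotProduct, neg_dotProduct, dotProduct_comm t y]
  ring

theorem integrable_gauss_ofReal {r : ℝ} (hr : 0 < r) :
    Integrable (fun t : Fin M → ℝ => (gauss r t : ℂ)) := (integrable_gauss hr).ofReal

theorem continuous_gauss_right (r : ℝ) : Continuous fun s : Fin M → ℝ => (gauss r s : ℂ) :=
  Complex.continuous_ofReal.comp (continuous_gauss.comp (by fun_prop : Continuous fun s => (r, s)))

theorem continuous_phase_right (t : Fin M → ℝ) : Continuous fun y => phase t y :=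
  continuous_phase.comp (by fun_prop : Continuous fun y => (t, y))

/-- The Gaussian-regularised Fourier inversion in the momentum variable. -/
theorem integral_gauss_mul_fourierCorrelation {r : ℝ} (hr : 0 < r) (ψ : ModeSpace M)
    (c s : Fin M → ℝ) :
    ∫ t, (gauss r t : ℂ) * phase (-c) t * fourierCorrelation ψ s t
      = ((2 * √Real.pi) ^ M : ℝ) * ∫ z, (gauss 1 z : ℂ) * correlation ψ s (c + (2 * r) • z) := by
  have hint : Integrable (fun p : (Fin M → ℝ) × (Fin M → ℝ) =>
      phase (p.2 - c) p.1 * ((gauss r p.1 : ℂ) * correlation ψ s p.2)) (volume.prod volume) := by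
    refine ((integrable_gauss_ofReal hr).mul_prod (integrable_correlation_right ψ s)).bdd_mul
      (c := 1) ?_ (Filter.Eventually.of_forall fun p => (norm_phase _ _).le)
    exact (continuous_phase.comp (by fun_prop : Continuous fun p : (Fin M → ℝ) × (Fin M → ℝ) =>
      (p.2 - c, p.1))).aestronglyMeasurable
  have h1 : ∫ t, (gauss r t : ℂ) * phase (-c) t * fourierCorrelation ψ s t
      = ∫ t, ∫ y, phase (y - c) t * ((gauss r t : ℂ) * correlation ψ s y) := by
    refine integral_congr_ae (Filter.Eventually.of_forall fun t => ?_)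
    simp only [fourierCorrelation]
    rw [← integral_const_mul]
    refine integral_congr_ae (Filter.Eventually.of_forall fun y => ?_)
    simp only [← phase_sub_left]
    ring
  have h2 : ∀ y, ∫ t, phase (y - c) t * ((gauss r t : ℂ) * correlation ψ s y)
      = ((√Real.pi / r) ^ M : ℝ) * (gauss (1 / (2 * r)) (y - c) * correlation ψ s y) := by
    intro y
    rw [← mul_assoc, ← integral_gauss_mul_phase hr, ← integral_mul_const]
    refine integral_congr_ae (Filter.Eventually.of_forall fun t => ?_)
    simp only
    ring
  rw [h1, integral_integral_swap hint]
  simp only [h2]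
  rw [integral_const_mul, ← integral_add_left_eq_self _ c]
  -- The substitution `y = c + 2 r z` removes `r` from the kernel, and `(√π / r) · 2 r` gives the
  -- constant `2 √π` per mode.
  have h3 := Measure.integral_comp_smul_of_nonneg (volume : Measure (Fin M → ℝ))
    (fun y => (gauss (1 / (2 * r)) (c + y - c) : ℂ) * correlation ψ s (c + y)) (2 * r)
    (hR := by positivity)
  rw [Module.finrank_fin_fun] at h3
  have h4 : ∀ z : Fin M → ℝ, gauss (1 / (2 * r)) (c + (2 * r) • z - c) = gauss 1 z := fun z => by
    rw [add_sub_cancel_left, gauss_smul]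
    congr 1
    field_simp
  simp only [h4] at h3
  rw [h3, Complex.real_smul, ← mul_assoc, ← Complex.ofReal_mul]
  congr 2
  rw [← inv_pow, ← mul_pow]
  congr 1
  field_simp

/-- Integrating over `s` first leaves at most `gauss 1 z * ‖ψ‖ ^ 2`, which is integrable in `z`. The
factor `gauss r` is only used through its bound by `1`. -/
theorem integrable_gauss_mul_correlation {r : ℝ} (ψ : ModeSpace M) (B c : Fin M → ℝ) :
    Integrable (fun p : (Fin M → ℝ) × (Fin M → ℝ) => (gauss 1 p.2 : ℂ) *
      ((gauss r p.1 : ℂ) * phase B p.1 * correlation ψ p.1 (c + (2 * r) • p.2)))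
      (volume.prod volume) := by
  have hmeas : AEStronglyMeasurable (fun p : (Fin M → ℝ) × (Fin M → ℝ) => (gauss 1 p.2 : ℂ) *
      ((gauss r p.1 : ℂ) * phase B p.1 * correlation ψ p.1 (c + (2 * r) • p.2)))
      (volume.prod volume) := by
    refine StronglyMeasurable.aestronglyMeasurable ?_
    refine ((continuous_gauss_right 1).comp continuous_snd).stronglyMeasurable.mul
      (((((continuous_gauss_right r).comp continuous_fst).mul
        ((continuous_phase_right B).comp continuous_fst)).stronglyMeasurable).mul ?_)
    exact (stronglyMeasurable_correlation ψ).comp_measurable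
      (by fun_prop : Measurable fun p : (Fin M → ℝ) × (Fin M → ℝ) => (p.1, c + (2 * r) • p.2))
  have hle : ∀ s z : Fin M → ℝ, ‖(gauss 1 z : ℂ) *
      ((gauss r s : ℂ) * phase B s * correlation ψ s (c + (2 * r) • z))‖
      ≤ gauss 1 z * ‖correlation ψ s (c + (2 * r) • z)‖ := fun s z => by
    rw [norm_mul, norm_mul, norm_mul, norm_phase, mul_one, Complex.norm_real,
      Real.norm_of_nonneg (gauss_pos 1 z).le]
    exact mul_le_mul_of_nonneg_left (mul_le_of_le_one_left (norm_nonneg _) (norm_gauss_le_one r s))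
      (gauss_pos 1 z).le
  have hz : ∀ z : Fin M → ℝ, Integrable (fun s => (gauss 1 z : ℂ) *
      ((gauss r s : ℂ) * phase B s * correlation ψ s (c + (2 * r) • z))) := fun z => by
    refine (Integrable.bdd_mul (integrable_correlation_left ψ (c + (2 * r) • z))
      (c := 1) ?_ (Filter.Eventually.of_forall fun s => ?_)).const_mul _
    · exact ((continuous_gauss_right r).mul (continuous_phase_right B)).aestronglyMeasurable
    · rw [norm_mul, norm_phase, mul_one]
      exact norm_gauss_le_one r s
  rw [integrable_prod_iff' hmeas]
  refine ⟨Filter.Eventually.of_forall hz, ?_⟩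
  refine ((integrable_gauss one_pos).mul_const (‖ψ‖ ^ 2)).mono'
    hmeas.norm.prod_swap.integral_prod_right' (Filter.Eventually.of_forall fun z => ?_)
  rw [Real.norm_of_nonneg (by positivity)]
  refine (integral_mono (hz z).norm
    ((integrable_correlation_left ψ (c + (2 * r) • z)).norm.const_mul _) (fun s => hle s z)).trans ?_
  rw [integral_const_mul]
  exact mul_le_mul_of_nonneg_left (integral_norm_correlation_left_le ψ _) (gauss_pos 1 z).le

/-- The regularised expectation of a displacement operator with displacement `c + 2 r z`. -/
def regularised (ψ : ModeSpace M) (B c : Fin M → ℝ) (r : ℝ) (z : Fin M → ℝ) : ℂ :=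
  ∫ s, (gauss r s : ℂ) * phase B s * correlation ψ s (c + (2 * r) • z)

/-- The Gaussian average of the regularised expectations. -/
def gaussAverage (ψ : ModeSpace M) (B c : Fin M → ℝ) (r : ℝ) : ℂ :=
  ((√Real.pi ^ M)⁻¹ : ℝ) * ∫ z, (gauss 1 z : ℂ) * regularised ψ B c r z

theorem integral_gauss_mul_gauss_mul_fourierCorrelation {r : ℝ} (hr : 0 < r) (ψ : ModeSpace M)
    (B c : Fin M → ℝ) :
    ∫ s, ∫ t, (gauss r s : ℂ) * phase B s *
      ((gauss r t : ℂ) * phase (-c) t * fourierCorrelation ψ s t)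
      = ((2 * Real.pi) ^ M : ℝ) * gaussAverage ψ B c r := by
  simp only [integral_const_mul, integral_gauss_mul_fourierCorrelation hr]
  have h1 : ∀ s : Fin M → ℝ, (gauss r s : ℂ) * phase B s * ((((2 * √Real.pi) ^ M : ℝ) : ℂ) *
      ∫ z, (gauss 1 z : ℂ) * correlation ψ s (c + (2 * r) • z))
      = (((2 * √Real.pi) ^ M : ℝ) : ℂ) * ∫ z, (gauss 1 z : ℂ) *
        ((gauss r s : ℂ) * phase B s * correlation ψ s (c + (2 * r) • z)) := fun s => by
    rw [mul_left_comm, ← integral_const_mul]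
    congr 1
    refine integral_congr_ae (Filter.Eventually.of_forall fun z => ?_)
    simp only
    ring
  simp only [h1]
  rw [integral_const_mul, integral_integral_swap (integrable_gauss_mul_correlation ψ B c)]
  simp only [integral_const_mul]
  rw [gaussAverage, ← mul_assoc, ← Complex.ofReal_mul]
  congr 2
  rw [← inv_pow, ← mul_pow]
  congr 1
  have h2 := Real.mul_self_sqrt Real.pi_pos.le
  have h3 : √Real.pi ≠ 0 := (Real.sqrt_pos.2 Real.pi_pos).ne'
  field_simp
  linear_combination h2

theorem norm_regularised_le (ψ : ModeSpace M) (B c : Fin M → ℝ) (r : ℝ) (z : Fin M → ℝ) :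
    ‖regularised ψ B c r z‖ ≤ ‖ψ‖ ^ 2 := by
  refine (norm_integral_le_of_norm_le (integrable_correlation_left ψ _).norm
    (Filter.Eventually.of_forall fun s => ?_)).trans
    (integral_norm_correlation_left_le ψ (c + (2 * r) • z))
  rw [norm_mul, norm_mul, norm_phase, mul_one]
  exact mul_le_of_le_one_left (norm_nonneg _) (norm_gauss_le_one r s)

theorem norm_gauss_mul_regularised_le (ψ : ModeSpace M) (B c : Fin M → ℝ) (r : ℝ)
    (z : Fin M → ℝ) : ‖(gauss 1 z : ℂ) * regularised ψ B c r z‖ ≤ gauss 1 z * ‖ψ‖ ^ 2 := by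
  rw [norm_mul, Complex.norm_real, Real.norm_of_nonneg (gauss_pos 1 z).le]
  exact mul_le_mul_of_nonneg_left (norm_regularised_le ψ B c r z) (gauss_pos 1 z).le

/-- The Gaussian is normalised to total mass one. As the bound does not depend on `r`, it dominates
the series over the vectors of a mixed state. -/
theorem norm_gaussAverage_le (ψ : ModeSpace M) (B c : Fin M → ℝ) (r : ℝ) :
    ‖gaussAverage ψ B c r‖ ≤ ‖ψ‖ ^ 2 := by
  have h0 : 0 < √Real.pi ^ M := pow_pos (Real.sqrt_pos.2 Real.pi_pos) M
  rw [gaussAverage, norm_mul, Complex.norm_real, Real.norm_of_nonneg (inv_nonneg.2 h0.le),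
    inv_mul_le_iff₀ h0, ← integral_gauss_one, ← integral_mul_const]
  exact norm_integral_le_of_norm_le ((integrable_gauss one_pos).mul_const _)
    (Filter.Eventually.of_forall fun z => norm_gauss_mul_regularised_le ψ B c r z)

/-- Two errors vanish separately: removing `gauss r` at the fixed offset `c` by dominated
convergence, and moving the offset from `c + 2 r z` to `c` by `L¹` continuity of the correlation. -/
theorem tendsto_regularised (ψ : ModeSpace M) (B c z : Fin M → ℝ) :
    Filter.Tendsto (fun r => regularised ψ B c r z) (nhds 0)
      (nhds (∫ s, phase B s * correlation ψ s c)) := by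
  have hint : ∀ r y, Integrable (fun s => (gauss r s : ℂ) * phase B s * correlation ψ s y) :=
    fun r y => by
      refine Integrable.bdd_mul (integrable_correlation_left ψ y)
        (c := 1) ?_ (Filter.Eventually.of_forall fun s => ?_)
      · exact ((continuous_gauss_right r).mul (continuous_phase_right B)).aestronglyMeasurable
      · rw [norm_mul, norm_phase, mul_one]
        exact norm_gauss_le_one r s
  have h1 : Filter.Tendsto (fun r => ∫ s, (gauss r s : ℂ) * phase B s * correlation ψ s c) (nhds 0)
      (nhds (∫ s, phase B s * correlation ψ s c)) := by
    refine tendsto_integral_filter_of_dominated_convergence (fun s => ‖correlation ψ s c‖)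
      (Filter.Eventually.of_forall fun r => (hint r c).aestronglyMeasurable)
      (Filter.Eventually.of_forall fun r => Filter.Eventually.of_forall fun s => ?_)
      (integrable_correlation_left ψ c).norm (Filter.Eventually.of_forall fun s => ?_)
    · rw [norm_mul, norm_mul, norm_phase, mul_one]
      exact mul_le_of_le_one_left (norm_nonneg _) (norm_gauss_le_one r s)
    · have hg : Continuous fun r : ℝ => (gauss r s : ℂ) * phase B s * correlation ψ s c :=
        ((Complex.continuous_ofReal.comp (continuous_gauss.comp
          (by fun_prop : Continuous fun r : ℝ => (r, s)))).mul continuous_const).mul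
            continuous_const
      have := hg.tendsto 0
      simpa [gauss] using this
  have h2 : Filter.Tendsto (fun r => regularised ψ B c r z
      - ∫ s, (gauss r s : ℂ) * phase B s * correlation ψ s c) (nhds 0) (nhds 0) := by
    have hy : Filter.Tendsto (fun r : ℝ => c + (2 * r) • z) (nhds 0) (nhds c) := by
      have : Continuous fun r : ℝ => c + (2 * r) • z := by fun_prop
      simpa using this.tendsto 0
    refine squeeze_zero_norm (fun r => ?_) ((tendsto_integral_norm_correlation_sub ψ c).comp hy)
    rw [regularised, ← integral_sub (hint _ _) (hint _ _)]
    refine norm_integral_le_of_norm_le ((integrable_correlation_left ψ _).sub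
      (integrable_correlation_left ψ c)).norm (Filter.Eventually.of_forall fun s => ?_)
    rw [← mul_sub, norm_mul, norm_mul, norm_phase, mul_one]
    exact mul_le_of_le_one_left (norm_nonneg _) (norm_gauss_le_one r s)
  simpa using h2.add h1

theorem tendsto_gaussAverage (ψ : ModeSpace M) (B c : Fin M → ℝ) :
    Filter.Tendsto (fun r => gaussAverage ψ B c r) (nhds 0)
      (nhds (∫ s, phase B s * correlation ψ s c)) := by
  have h1 : Filter.Tendsto (fun r => ∫ z, (gauss 1 z : ℂ) * regularised ψ B c r z) (nhds 0)
      (nhds (∫ z : Fin M → ℝ, (gauss 1 z : ℂ) * ∫ s, phase B s * correlation ψ s c)) := by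
    refine tendsto_integral_filter_of_dominated_convergence (fun z => gauss 1 z * ‖ψ‖ ^ 2)
      (Filter.Eventually.of_forall fun r => ?_)
      (Filter.Eventually.of_forall fun r => Filter.Eventually.of_forall fun z =>
        norm_gauss_mul_regularised_le ψ B c r z)
      ((integrable_gauss one_pos).mul_const _) (Filter.Eventually.of_forall fun z =>
        (tendsto_regularised ψ B c z).const_mul _)
    have := (integrable_gauss_mul_correlation (r := r) ψ B c).swap.integral_prod_left
    simp only [Function.comp_apply, Prod.swap_prod_mk, integral_const_mul] at this
    exact this.aestronglyMeasurable
  have h2 := h1.const_mul (((√Real.pi ^ M)⁻¹ : ℝ) : ℂ)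
  rw [integral_mul_const, integral_complex_ofReal, integral_gauss_one, ← mul_assoc,
    ← Complex.ofReal_mul, inv_mul_cancel₀ (pow_pos (Real.sqrt_pos.2 Real.pi_pos) M).ne',
    Complex.ofReal_one, one_mul] at h2
  exact h2

end Smoothing

/-! ### The regularised Weyl formula on phase space -/

section PhaseSpace

variable {M : ℕ}

/-- The real and imaginary parts of a point of phase space. -/
def reImEquiv (M : ℕ) : (Fin M → ℂ) ≃ᵐ (Fin M → ℝ) × (Fin M → ℝ) :=
  (MeasurableEquiv.piCongrRight fun _ => Complex.measurableEquivRealProd).trans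
    (MeasurableEquiv.arrowProdEquivProdArrow ℝ ℝ (Fin M))

theorem measurePreserving_reImEquiv : MeasurePreserving (reImEquiv M) :=
  (volume_measurePreserving_arrowProdEquivProdArrow ℝ ℝ (Fin M)).comp
    (volume_preserving_pi fun _ => Complex.volume_preserving_equiv_real_prod)

/-- The scaled quadratures `(√2 Re α, 2√2 Im α)` of a point of phase space. -/
def quadratures (α : Fin M → ℂ) : (Fin M → ℝ) × (Fin M → ℝ) :=
  (fun m => √2 * (α m).re, fun m => 2 * √2 * (α m).im)

theorem continuous_quadratures : Continuous (quadratures (M := M)) := by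
  unfold quadratures
  fun_prop

/-- The Jacobian is `√2 · 2√2 = 4` per mode. -/
theorem integral_comp_quadratures (F : (Fin M → ℝ) × (Fin M → ℝ) → ℂ)
    (hF : Integrable fun α => F (quadratures α)) :
    ∫ α, F (quadratures α) = ((4 ^ M)⁻¹ : ℝ) * ∫ s, ∫ t, F (s, t) := by
  have h1 := measurePreserving_reImEquiv.integral_comp (reImEquiv M).measurableEmbedding
    (fun p => F (√2 • p.1, (2 * √2) • p.2))
  have h2 := (measurePreserving_reImEquiv.integrable_comp_emb (reImEquiv M).measurableEmbedding
    (g := fun p => F (√2 • p.1, (2 * √2) • p.2))).1 hF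
  refine h1.trans ?_
  rw [Measure.volume_eq_prod] at h2 ⊢
  rw [integral_prod _ h2]
  have h3 : ∀ s : Fin M → ℝ, ∫ t : Fin M → ℝ, F (s, (2 * √2) • t)
      = (((2 * √2) ^ M)⁻¹ : ℝ) • ∫ t, F (s, t) := fun s => by
    rw [Measure.integral_comp_smul_of_nonneg volume (fun t => F (s, t)) (2 * √2)
      (hR := by positivity), Module.finrank_fin_fun]
  simp only [h3]
  rw [integral_smul, Measure.integral_comp_smul_of_nonneg volume (fun s => ∫ t, F (s, t)) √2
      (hR := by positivity), Module.finrank_fin_fun, smul_smul, Complex.real_smul]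
  congr 2
  rw [← mul_inv, ← mul_pow]
  congr 2
  linear_combination 2 * Real.mul_self_sqrt (show (0 : ℝ) ≤ 2 by norm_num)

/-- A Gaussian regulator on phase space. -/
def regulator (r : ℝ) (α : Fin M → ℂ) : ℝ :=
  gauss r (quadratures α).1 * gauss r (quadratures α).2

theorem regulator_pos (r : ℝ) (α : Fin M → ℂ) : 0 < regulator r α :=
  mul_pos (gauss_pos _ _) (gauss_pos _ _)

theorem regulator_le_one (r : ℝ) (α : Fin M → ℂ) : regulator r α ≤ 1 :=
  mul_le_one₀ (gauss_le_one _ _) (gauss_pos _ _).le (gauss_le_one _ _)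

theorem integrable_regulator {r : ℝ} (hr : 0 < r) :
    Integrable (fun α : Fin M → ℂ => regulator r α) := by
  have h : Integrable (fun p : (Fin M → ℝ) × (Fin M → ℝ) =>
      gauss (r * √2) p.1 * gauss (r * (2 * √2)) p.2) (volume.prod volume) :=
    (integrable_gauss (by positivity)).mul_prod (integrable_gauss (by positivity))
  rw [← Measure.volume_eq_prod] at h
  refine ((measurePreserving_reImEquiv.integrable_comp_emb
    (reImEquiv M).measurableEmbedding).2 h).congr (Filter.Eventually.of_forall fun α => ?_)
  simp only [Function.comp_apply, ← gauss_smul]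
  rfl

theorem phase_sub (a b y : Fin M → ℝ) :
    phase (a - b) y = phase a y * starRingEnd ℂ (phase b y) := by
  rw [phase, phase, phase, ← Complex.exp_conj, ← Complex.exp_add, sub_dotProduct, map_mul,
    Complex.conj_ofReal, Complex.conj_I]
  congr 1
  push_cast
  ring

/-- The Weyl symbol `exp (ξ·α* - ξ*·α)` of the displacement operator `D(ξ)`. -/
def weylChar (ξ α : Fin M → ℂ) : ℂ :=
  phase (fun m => √2 * (ξ m).im) (quadratures α).1 *
    phase (-fun m => (ξ m).re / √2) (quadratures α).2

theorem norm_weylChar (ξ α : Fin M → ℂ) : ‖weylChar ξ α‖ = 1 := by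
  rw [weylChar, norm_mul, norm_phase, norm_phase, one_mul]

theorem continuous_weylChar (ξ : Fin M → ℂ) : Continuous (weylChar ξ) :=
  ((continuous_phase_right _).comp (continuous_fst.comp continuous_quadratures)).mul
    ((continuous_phase_right _).comp (continuous_snd.comp continuous_quadratures))

/-- This multiplicativity is what makes the quadratic form of the matrix a squared modulus under the
integral. -/
theorem weylChar_sub (ξ η α : Fin M → ℂ) :
    weylChar (ξ - η) α = weylChar ξ α * starRingEnd ℂ (weylChar η α) := by
  have h1 : (fun m => √2 * ((ξ - η) m).im)
      = (fun m => √2 * (ξ m).im) - fun m => √2 * (η m).im := by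
    funext m
    simp [mul_sub]
  have h2 : (-fun m => ((ξ - η) m).re / √2)
      = (-fun m => (ξ m).re / √2) - -fun m => (η m).re / √2 := by
    funext m
    simp [sub_div]
    ring
  rw [weylChar, weylChar, weylChar, h1, h2, phase_sub, phase_sub, map_mul]
  ring

/-- The displaced parity operator `D(α) Π D(α)†`. -/
abbrev displacedParity (α : Fin M → ℂ) : ModeSpace M →L[ℂ] ModeSpace M :=
  displacement α ∘L parity M ∘L ContinuousLinearMap.adjoint (displacement α)

theorem inner_displacedParity (α : Fin M → ℂ) (ψ : ModeSpace M) :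
    inner ℂ ψ (displacedParity α ψ)
      = fourierCorrelation ψ (quadratures α).1 (quadratures α).2 := inner_displacement_parity α ψ

theorem stronglyMeasurable_fourierCorrelation (ψ : ModeSpace M) :
    StronglyMeasurable fun p : (Fin M → ℝ) × (Fin M → ℝ) => fourierCorrelation ψ p.1 p.2 := by
  have h : StronglyMeasurable fun q : ((Fin M → ℝ) × (Fin M → ℝ)) × (Fin M → ℝ) =>
      phase q.1.2 q.2 * correlation ψ q.1.1 q.2 :=
    (continuous_phase.comp (by fun_prop : Continuous
      fun q : ((Fin M → ℝ) × (Fin M → ℝ)) × (Fin M → ℝ) => (q.1.2, q.2))).stronglyMeasurable.mul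
      ((stronglyMeasurable_correlation ψ).comp_measurable (by fun_prop : Measurable
        fun q : ((Fin M → ℝ) × (Fin M → ℝ)) × (Fin M → ℝ) => (q.1.1, q.2)))
  exact h.integral_prod_right

theorem norm_fourierCorrelation_le (ψ : ModeSpace M) (s t : Fin M → ℝ) :
    ‖fourierCorrelation ψ s t‖ ≤ ‖ψ‖ ^ 2 := by
  refine (norm_integral_le_of_norm_le (integrable_correlation_right ψ s).norm
    (Filter.Eventually.of_forall fun y => ?_)).trans (integral_norm_correlation_right_le ψ s)
  rw [norm_mul, norm_phase, one_mul]

theorem norm_regulator_mul_inner_le (r : ℝ) (ξ α : Fin M → ℂ) (ψ : ModeSpace M) :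
    ‖(regulator r α : ℂ) * weylChar ξ α * inner ℂ ψ (displacedParity α ψ)‖
      ≤ regulator r α * ‖ψ‖ ^ 2 := by
  rw [norm_mul, norm_mul, norm_weylChar, mul_one, Complex.norm_real,
    Real.norm_of_nonneg (regulator_pos r α).le, inner_displacedParity]
  exact mul_le_mul_of_nonneg_left (norm_fourierCorrelation_le _ _ _) (regulator_pos r α).le

theorem integrable_regulator_mul_inner {r : ℝ} (hr : 0 < r) (ξ : Fin M → ℂ) (ψ : ModeSpace M) :
    Integrable fun α => (regulator r α : ℂ) * weylChar ξ α * inner ℂ ψ (displacedParity α ψ) := by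
  refine ((integrable_regulator hr).mul_const (‖ψ‖ ^ 2)).mono' ?_
    (Filter.Eventually.of_forall fun α => norm_regulator_mul_inner_le r ξ α ψ)
  simp only [inner_displacedParity]
  refine ((integrable_regulator hr).ofReal.aestronglyMeasurable.mul
    (continuous_weylChar ξ).aestronglyMeasurable).mul ?_
  exact ((stronglyMeasurable_fourierCorrelation ψ).comp_measurable
    continuous_quadratures.measurable).aestronglyMeasurable

theorem integral_regulator_mul_inner {r : ℝ} (hr : 0 < r) (ξ : Fin M → ℂ) (ψ : ModeSpace M) :
    ((2 / Real.pi) ^ M : ℝ) *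
      ∫ α, (regulator r α : ℂ) * weylChar ξ α * inner ℂ ψ (displacedParity α ψ)
      = gaussAverage ψ (fun m => √2 * (ξ m).im) (fun m => (ξ m).re / √2) r := by
  have h := integrable_regulator_mul_inner hr ξ ψ
  let F : (Fin M → ℝ) × (Fin M → ℝ) → ℂ := fun p =>
    (gauss r p.1 : ℂ) * phase (fun m => √2 * (ξ m).im) p.1 *
      ((gauss r p.2 : ℂ) * phase (-fun m => (ξ m).re / √2) p.2 * fourierCorrelation ψ p.1 p.2)
  have e : ∀ α, (regulator r α : ℂ) * weylChar ξ α * inner ℂ ψ (displacedParity α ψ)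
      = F (quadratures α) := fun α => by
    simp only [F, regulator, weylChar, inner_displacedParity]
    push_cast
    ring
  simp only [e] at h ⊢
  rw [integral_comp_quadratures F h]
  simp only [F]
  rw [integral_gauss_mul_gauss_mul_fourierCorrelation hr, ← mul_assoc, ← mul_assoc,
    ← Complex.ofReal_mul, ← Complex.ofReal_mul, ← inv_pow, ← mul_pow, ← mul_pow]
  -- Per mode: the Wigner normalisation, the Jacobian of the quadratures and the constant of Fourier
  -- inversion.
  have h1 : 2 / Real.pi * 4⁻¹ * (2 * Real.pi) = 1 := by
    field_simp
    norm_num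
  rw [h1, one_pow, Complex.ofReal_one, one_mul]

theorem tendsto_integral_regulator_mul_inner (ξ : Fin M → ℂ) (ψ : ModeSpace M) :
    Filter.Tendsto (fun r => gaussAverage ψ (fun m => √2 * (ξ m).im) (fun m => (ξ m).re / √2) r)
      (nhdsWithin 0 (Set.Ioi 0)) (nhds (inner ℂ ψ (displacement ξ ψ))) := by
  rw [inner_displacement]
  exact (tendsto_gaussAverage ψ _ _).mono_left nhdsWithin_le_nhds

end PhaseSpace

/-! ### Passage to mixed states -/

section Mixed

variable {M : ℕ} {ρ : ModeSpace M →L[ℂ] ModeSpace M}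

/-- The rigorous form of `tr[ρ D(ξ)] = ∫ W_ρ χ_ξ`: the one-vector formula is summed over the vectors
`ψᵢ`, with `∑ ‖ψᵢ‖² = 1` dominating both the exchange with the integral and the limit. -/
theorem integrable_and_tendsto_regulator_mul_trace (hρ : IsDensityOperator ρ) (ξ : Fin M → ℂ) :
    (∀ r > 0, Integrable fun α =>
      (regulator r α : ℂ) * weylChar ξ α * trace (ρ ∘L displacedParity α)) ∧
    Filter.Tendsto (fun r => (((2 / Real.pi) ^ M : ℝ) : ℂ) *
      ∫ α, (regulator r α : ℂ) * weylChar ξ α * trace (ρ ∘L displacedParity α))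
      (nhdsWithin 0 (Set.Ioi 0)) (nhds (trace (ρ ∘L displacement ξ))) := by
  obtain ⟨J, ψ, hJ, hψ, htr⟩ := hρ.exists_hasSum_inner
  have : Countable J := hJ
  have hsum : ∀ r α, HasSum (fun i => (regulator r α : ℂ) * weylChar ξ α *
      inner ℂ (ψ i) (displacedParity α (ψ i)))
      ((regulator r α : ℂ) * weylChar ξ α * trace (ρ ∘L displacedParity α)) := fun r α =>
    (htr (displacedParity α)).mul_left _
  have hI : ∀ r > 0, Summable fun i => ∫ α, ‖(regulator r α : ℂ) * weylChar ξ α *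
      inner ℂ (ψ i) (displacedParity α (ψ i))‖ := fun r hr => by
    refine Summable.of_nonneg_of_le (fun i => by positivity) (fun i => ?_)
      (hψ.summable.mul_left (∫ α : Fin M → ℂ, regulator r α))
    rw [← integral_mul_const]
    exact integral_mono (integrable_regulator_mul_inner hr ξ (ψ i)).norm
      ((integrable_regulator hr).mul_const _) fun α => norm_regulator_mul_inner_le r ξ α (ψ i)
  refine ⟨fun r hr => ?_, ?_⟩
  · refine (integrable_regulator hr).mono' ?_ (Filter.Eventually.of_forall fun α => ?_)
    · exact aestronglyMeasurable_of_tendsto_ae (Filter.atTop : Filter (Finset J))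
        (fun s => Finset.aestronglyMeasurable_fun_sum s fun i _ =>
          (integrable_regulator_mul_inner hr ξ (ψ i)).aestronglyMeasurable)
        (Filter.Eventually.of_forall fun α => hsum r α)
    · have h1 := tsum_of_norm_bounded (hψ.mul_left (regulator r α))
        fun i => norm_regulator_mul_inner_le r ξ α (ψ i)
      rwa [(hsum r α).tsum_eq, mul_one] at h1
  · have h1 := tendsto_tsum_of_dominated_convergence (𝓕 := nhdsWithin 0 (Set.Ioi 0)) hψ.summable
      (fun i => tendsto_integral_regulator_mul_inner ξ (ψ i))
      (Filter.Eventually.of_forall fun r i => norm_gaussAverage_le (ψ i) _ _ r)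
    rw [(htr (displacement ξ)).tsum_eq] at h1
    refine h1.congr' ?_
    -- For `r > 0` the sum of the Gaussian averages is the regularised integral of the trace.
    filter_upwards [self_mem_nhdsWithin] with r hr
    have h2 := hasSum_integral_of_summable_integral_norm
      (fun i => integrable_regulator_mul_inner hr ξ (ψ i)) (hI r hr)
    simp only [(hsum r _).tsum_eq] at h2
    have h3 := h2.mul_left (((2 / Real.pi) ^ M : ℝ) : ℂ)
    simp only [integral_regulator_mul_inner hr] at h3
    exact h3.tsum_eq

end Mixed

/-! ### The smallest eigenvalue is attained -/

section Eigenvalues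

variable {N : ℕ} {C : Matrix (Fin N) (Fin N) ℂ}

/-- The set of real eigenvalues is finite, and nonempty by the spectral theorem since `N > 0`, so
its infimum is a minimum. -/
theorem isLeast_smallestEigenvalue (hN : 0 < N) (hC : C.IsHermitian) :
    IsLeast (realEigenvalues C) (smallestEigenvalue C) := by
  have hfin : (realEigenvalues C).Finite :=
    (Module.End.finite_hasEigenvalue (Matrix.toLin' C)).preimage
      Complex.ofReal_injective.injOn
  have hne : (realEigenvalues C).Nonempty := by
    refine ⟨hC.eigenvalues ⟨0, hN⟩, Module.End.hasEigenvalue_of_hasEigenvector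
      (x := (hC.eigenvectorBasis ⟨0, hN⟩ : Fin N → ℂ)) ⟨?_, ?_⟩⟩
    · rw [Module.End.mem_eigenspace_iff, Matrix.toLin'_apply, hC.mulVec_eigenvectorBasis]
      rfl
    · intro h
      refine hC.eigenvectorBasis.orthonormal.ne_zero ⟨0, hN⟩ ?_
      ext m
      exact congrFun h m
  exact ⟨hne.csInf_mem hfin, fun μ hμ => csInf_le hfin.bddBelow hμ⟩

end Eigenvalues

/-! ### Lower bound of the quadratic form -/

section QuadraticForm

variable {M N : ℕ} {ρ : ModeSpace M →L[ℂ] ModeSpace M}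

theorem star_trace_displacement (hρ : IsDensityOperator ρ) (ξ : Fin M → ℂ) :
    star (trace (ρ ∘L displacement ξ)) = trace (ρ ∘L displacement (-ξ)) := by
  obtain ⟨J, ψ, -, -, htr⟩ := hρ.exists_hasSum_inner
  have h := (htr (displacement ξ)).star
  refine h.unique ?_
  have e : ∀ i, star (inner ℂ (ψ i) (displacement ξ (ψ i)))
      = inner ℂ (ψ i) (displacement (-ξ) (ψ i)) := fun i => by
    rw [← adjoint_displacement, ContinuousLinearMap.adjoint_inner_right]
    exact inner_conj_symm _ _
  simpa only [e] using htr (displacement (-ξ))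

theorem isHermitian_charMatrix (hρ : IsDensityOperator ρ) (Ξ : Fin N → Fin M → ℂ) :
    (charMatrix ρ Ξ).IsHermitian := by
  ext j k
  rw [Matrix.conjTranspose_apply]
  simp only [charMatrix, Matrix.of_apply, star_mul']
  rw [star_trace_displacement hρ, neg_sub]
  simp

/-- The squared modulus of a trigonometric polynomial on phase space. -/
def trigWeight (Ξ : Fin N → Fin M → ℂ) (u : Fin N → ℂ) (α : Fin M → ℂ) : ℝ :=
  ‖∑ j, star (u j) * weylChar (Ξ j) α‖ ^ 2

theorem trigWeight_eq (Ξ : Fin N → Fin M → ℂ) (u : Fin N → ℂ) (α : Fin M → ℂ) :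
    (trigWeight Ξ u α : ℂ) = ∑ j, ∑ k, star (u j) * u k * weylChar (Ξ j - Ξ k) α := by
  rw [trigWeight, Complex.ofReal_pow, ← Complex.mul_conj', map_sum, Finset.sum_mul_sum]
  refine Finset.sum_congr rfl fun j _ => Finset.sum_congr rfl fun k _ => ?_
  rw [weylChar_sub, map_mul, ← starRingEnd_apply, ← starRingEnd_apply, Complex.conj_conj]
  ring

/-- Cauchy-Schwarz over the `N` unimodular characters. The factor `N` is the one that the
normalisation `1/N` of the matrix absorbs. -/
theorem trigWeight_le (Ξ : Fin N → Fin M → ℂ) (u : Fin N → ℂ) (α : Fin M → ℂ) :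
    trigWeight Ξ u α ≤ N * ∑ j, ‖u j‖ ^ 2 := by
  have h1 : ‖∑ j, star (u j) * weylChar (Ξ j) α‖ ≤ ∑ j, ‖u j‖ := by
    refine (norm_sum_le _ _).trans_eq (Finset.sum_congr rfl fun j _ => ?_)
    rw [norm_mul, norm_weylChar, mul_one, norm_star]
  have h2 := sq_sum_le_card_mul_sum_sq (s := (Finset.univ : Finset (Fin N))) (f := fun j => ‖u j‖)
  rw [Finset.card_univ, Fintype.card_fin] at h2
  exact (pow_le_pow_left₀ (norm_nonneg _) h1 2).trans h2

theorem wigner_eq (ρ : ModeSpace M →L[ℂ] ModeSpace M) (α : Fin M → ℂ) :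
    wigner ρ α = (2 / Real.pi) ^ M * (trace (ρ ∘L displacedParity α)).re := rfl

theorem integrable_regulator_mul_trigWeight_mul_wigner (hρ : IsDensityOperator ρ)
    (Ξ : Fin N → Fin M → ℂ) (u : Fin N → ℂ) {r : ℝ} (hr : 0 < r) :
    Integrable (fun α => regulator r α * trigWeight Ξ u α * wigner ρ α) ∧
    ∫ α, regulator r α * trigWeight Ξ u α * wigner ρ α
      = (∑ j, ∑ k, star (u j) * u k * ((((2 / Real.pi) ^ M : ℝ) : ℂ) *
        ∫ α, (regulator r α : ℂ) * weylChar (Ξ j - Ξ k) α * trace (ρ ∘L displacedParity α))).re := by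
  have hint : ∀ j k, Integrable fun α => star (u j) * u k * ((((2 / Real.pi) ^ M : ℝ) : ℂ) *
      ((regulator r α : ℂ) * weylChar (Ξ j - Ξ k) α * trace (ρ ∘L displacedParity α))) :=
    fun j k => (((integrable_and_tendsto_regulator_mul_trace hρ (Ξ j - Ξ k)).1 r
      hr).const_mul _).const_mul _
  have hsum := integrable_finsetSum Finset.univ fun j _ =>
    integrable_finsetSum Finset.univ fun k _ => hint j k
  have e : ∀ α, regulator r α * trigWeight Ξ u α * wigner ρ α
      = (∑ j, ∑ k, star (u j) * u k * ((((2 / Real.pi) ^ M : ℝ) : ℂ) *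
      ((regulator r α : ℂ) * weylChar (Ξ j - Ξ k) α * trace (ρ ∘L displacedParity α)))).re := by
    intro α
    have h1 : ∑ j, ∑ k, star (u j) * u k * ((((2 / Real.pi) ^ M : ℝ) : ℂ) *
        ((regulator r α : ℂ) * weylChar (Ξ j - Ξ k) α * trace (ρ ∘L displacedParity α)))
        = ((regulator r α * trigWeight Ξ u α * (2 / Real.pi) ^ M : ℝ) : ℂ)
          * trace (ρ ∘L displacedParity α) := by
      rw [Complex.ofReal_mul, Complex.ofReal_mul, trigWeight_eq]
      simp only [Finset.mul_sum, Finset.sum_mul]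
      refine Finset.sum_congr rfl fun j _ => Finset.sum_congr rfl fun k _ => ?_
      ring
    rw [h1, Complex.re_ofReal_mul, wigner_eq]
    ring
  simp only [e]
  refine ⟨hsum.re, ?_⟩
  refine (integral_re hsum).trans ?_
  rw [integral_finsetSum _ fun j _ => integrable_finsetSum Finset.univ fun k _ => hint j k]
  simp only [integral_finsetSum _ fun k _ => hint _ k, integral_const_mul]
  rfl

/-- The positive part of the integral is dropped. In the negative part, `-W ≤ (|W| - W) / 2` and the
nonnegative weight is at most `N ∑ ‖uⱼ‖²`, uniformly in `r`. -/
theorem neg_negativityVolume_le_integral (hρ : IsDensityOperator ρ)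
    (Ξ : Fin N → Fin M → ℂ) (u : Fin N → ℂ) {r : ℝ} (hr : 0 < r)
    (hV : negativityVolume ρ ≠ ∞) :
    -(N * (∑ j, ‖u j‖ ^ 2) * (negativityVolume ρ).toReal)
      ≤ ∫ α, regulator r α * trigWeight Ξ u α * wigner ρ α := by
  have hint := (integrable_regulator_mul_trigWeight_mul_wigner hρ Ξ u hr).1
  have hK : (0 : ℝ) ≤ N * ∑ j, ‖u j‖ ^ 2 := by positivity
  rw [integral_eq_lintegral_pos_part_sub_lintegral_neg_part hint]
  have hle : ∫⁻ α, ENNReal.ofReal (-(regulator r α * trigWeight Ξ u α * wigner ρ α))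
      ≤ ENNReal.ofReal (N * ∑ j, ‖u j‖ ^ 2) * negativityVolume ρ := by
    rw [negativityVolume, ← lintegral_const_mul' _ _ (by simp),
      ← lintegral_const_mul' _ _ ENNReal.ofReal_ne_top]
    refine lintegral_mono fun α => ?_
    have hhalf : (1 / 2 : ℝ≥0∞) = ENNReal.ofReal (1 / 2) := by
      rw [ENNReal.ofReal_div_of_pos (by norm_num)]
      simp
    rw [hhalf, ← ENNReal.ofReal_mul (by norm_num), ← ENNReal.ofReal_mul hK]
    refine ENNReal.ofReal_le_ofReal ?_
    have h0 : 0 ≤ regulator r α * trigWeight Ξ u α :=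
      mul_nonneg (regulator_pos r α).le (sq_nonneg _)
    have h1 : regulator r α * trigWeight Ξ u α ≤ N * ∑ j, ‖u j‖ ^ 2 :=
      (mul_le_of_le_one_left (sq_nonneg _) (regulator_le_one r α)).trans (trigWeight_le Ξ u α)
    have h2 : -wigner ρ α ≤ 1 / 2 * (|wigner ρ α| - wigner ρ α) := by
      linarith [neg_le_abs (wigner ρ α)]
    have h3 : 0 ≤ 1 / 2 * (|wigner ρ α| - wigner ρ α) := by
      linarith [le_abs_self (wigner ρ α)]
    calc _ = regulator r α * trigWeight Ξ u α * -wigner ρ α := by ring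
      _ ≤ regulator r α * trigWeight Ξ u α * (1 / 2 * (|wigner ρ α| - wigner ρ α)) :=
        mul_le_mul_of_nonneg_left h2 h0
      _ ≤ _ := mul_le_mul_of_nonneg_right h1 h3
  have h4 := ENNReal.toReal_mono (ENNReal.mul_ne_top ENNReal.ofReal_ne_top hV) hle
  rw [ENNReal.toReal_mul, ENNReal.toReal_ofReal hK] at h4
  have h5 : 0 ≤ (∫⁻ α, ENNReal.ofReal (regulator r α * trigWeight Ξ u α * wigner ρ α)).toReal :=
    ENNReal.toReal_nonneg
  linarith

theorem neg_negativityVolume_le_quadraticForm (hρ : IsDensityOperator ρ)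
    (Ξ : Fin N → Fin M → ℂ) (u : Fin N → ℂ) (hV : negativityVolume ρ ≠ ∞) :
    -(N * (∑ j, ‖u j‖ ^ 2) * (negativityVolume ρ).toReal)
      ≤ (∑ j, ∑ k, star (u j) * u k * trace (ρ ∘L displacement (Ξ j - Ξ k))).re := by
  have hlim := (Complex.continuous_re.tendsto _).comp
    (tendsto_finsetSum Finset.univ fun j _ => tendsto_finsetSum Finset.univ fun k _ =>
      (integrable_and_tendsto_regulator_mul_trace hρ (Ξ j - Ξ k)).2.const_mul (star (u j) * u k))
  refine ge_of_tendsto hlim ?_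
  filter_upwards [self_mem_nhdsWithin] with r hr
  rw [Function.comp_apply, ← (integrable_regulator_mul_trigWeight_mul_wigner hρ Ξ u hr).2]
  exact neg_negativityVolume_le_integral hρ Ξ u hr hV

theorem neg_negativityVolume_le_of_mem_realEigenvalues (hN : 0 < N) (hρ : IsDensityOperator ρ)
    (Ξ : Fin N → Fin M → ℂ) (hV : negativityVolume ρ ≠ ∞) {μ : ℝ}
    (hμ : μ ∈ realEigenvalues (charMatrix ρ Ξ)) : -(negativityVolume ρ).toReal ≤ μ := by
  obtain ⟨u, hu, hu0⟩ := Module.End.HasEigenvalue.exists_hasEigenvector hμ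
  rw [Module.End.mem_eigenspace_iff, Matrix.toLin'_apply] at hu
  have hN' : (N : ℂ) ≠ 0 := by exact_mod_cast hN.ne'
  have hpos : 0 < ∑ j, ‖u j‖ ^ 2 := by
    obtain ⟨j, hj⟩ := Function.ne_iff.1 hu0
    exact Finset.sum_pos' (fun k _ => sq_nonneg _)
      ⟨j, Finset.mem_univ j, pow_pos (norm_pos_iff.2 hj) 2⟩
  -- The form lacks the factor `1/N` of `charMatrix`, whence the `N` on the right.
  have hform : ∑ j, ∑ k, star (u j) * u k * trace (ρ ∘L displacement (Ξ j - Ξ k))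
      = ((N * (∑ j, ‖u j‖ ^ 2) * μ : ℝ) : ℂ) := by
    have h1 : ∀ j, ∑ k, star (u j) * u k * trace (ρ ∘L displacement (Ξ j - Ξ k))
        = N * star (u j) * (μ * u j) := fun j => by
      have h2 : ∑ k, charMatrix ρ Ξ j k * u k = μ * u j := congrFun hu j
      rw [← h2, Finset.mul_sum]
      refine Finset.sum_congr rfl fun k _ => ?_
      rw [charMatrix, Matrix.of_apply]
      field_simp
    simp only [h1]
    push_cast
    rw [Finset.mul_sum, Finset.sum_mul]
    refine Finset.sum_congr rfl fun j _ => ?_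
    rw [← Complex.conj_mul', starRingEnd_apply]
    ring
  have h := neg_negativityVolume_le_quadraticForm hρ Ξ u hV
  rw [hform, Complex.ofReal_re, ← mul_neg] at h
  exact le_of_mul_le_mul_left h (mul_pos (by exact_mod_cast hN) hpos)

end QuadraticForm

end WignerNeg

end

theorem theorem1 {M N : ℕ} (hN : 0 < N)
    (ρ : WignerNeg.ModeSpace M →L[ℂ] WignerNeg.ModeSpace M)
    (hρ : WignerNeg.IsDensityOperator ρ) (Ξ : Fin N → Fin M → ℂ) :
    (WignerNeg.charMatrix ρ Ξ).IsHermitian ∧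
      IsLeast (WignerNeg.realEigenvalues (WignerNeg.charMatrix ρ Ξ))
        (WignerNeg.smallestEigenvalue (WignerNeg.charMatrix ρ Ξ)) ∧
      ENNReal.ofReal (WignerNeg.witness ρ Ξ) ≤ WignerNeg.negativityVolume ρ := by
  have hC := WignerNeg.isHermitian_charMatrix hρ Ξ
  have hleast := WignerNeg.isLeast_smallestEigenvalue hN hC
  refine ⟨hC, hleast, ?_⟩
  -- An infinite negativity volume makes the bound trivial; otherwise real-valued estimates apply.
  by_cases hV : WignerNeg.negativityVolume ρ = ∞
  · rw [hV]
    exact le_top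
  · refine ENNReal.ofReal_le_of_le_toReal (max_le ENNReal.toReal_nonneg ?_)
    exact neg_le.1
      (WignerNeg.neg_negativityVolume_le_of_mem_realEigenvalues hN hρ Ξ hV hleast.1)
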